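/- For real numbers $p,r$ define the Raney numbers by $A_0(p,r):=1$ and $$A_m(p,r):=\frac{r}{m!}\prod_{i=1}^{m-1}(mp+r-i)\qquad(m\ge 1),$$ and for $p\ge 1$ put $c(p):=\dfrac{p^p}{(p-1)^{p-1}}$, with $0^0=1$, so that $c(1)=1$. **Theorem.** Let $p,r$ be real numbers with $p\ge 1$ and $0\le r\le p$. Then there exists a Borel probability measure $\mu(p,r)$ on $\mathbb{R}$, with support contained in $[0,c(p)]$, whose moment sequence is $\{A_m(p,r)\}_{m=0}^\infty$; that is, for every $m\ge 0$ the function $x^m$ is $\mu(p,r)$-integrable and $$\int_{\mathbb{R}} x^m\,d\mu(p,r)(x)=A_m(p,r).$$ Moreover, $\mu(p,r)$ is the only Borel probability measure on $\mathbb{R}$ with this moment sequence. -/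

import Mathlib

/-- The Raney numbers (two-parameter Fuss-Catalan numbers):
`A_0(p,r) = 1` and `A_m(p,r) = (r / m!) * ∏_{i=1}^{m-1} (m p + r - i)` for `m ≥ 1`. -/
noncomputable def raneyNumber (p r : ℝ) (m : ℕ) : ℝ :=
  if m = 0 then 1
  else r / (Nat.factorial m : ℝ) * ∏ i ∈ Finset.Ico 1 m, ((m : ℝ) * p + r - (i : ℝ))

/-- The constant `c(p) = p^p / (p-1)^(p-1)`. At `p = 1` this uses `0^0 = 1`, so that `c(1) = 1`,
the limit of `c(p)` as `p` tends to `1` from the right. -/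
noncomputable def raneyBound (p : ℝ) : ℝ :=
  p ^ p / (p - 1) ^ (p - 1)

/-- `a` is the moment sequence of `μ`: every moment of `μ` exists (as an absolutely convergent
integral), and the `m`-th one equals `a m`. -/
def IsMomentSequenceOf (a : ℕ → ℝ) (μ : MeasureTheory.Measure ℝ) : Prop :=
  ∀ m : ℕ, MeasureTheory.Integrable (fun x : ℝ => x ^ m) μ ∧ ∫ x : ℝ, x ^ m ∂μ = a m

/-!
If `z = (B - 1) / B ^ p` defines `B` as a power series in `z` with `B(0) = 1`, then the Raney
numbers `A_m(p, r)` are the Taylor coefficients of `B ^ r`, that is, the contour integrals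
`(2πi)⁻¹ ∮ B ^ r z ^ (-m-1) dz` around `B = 1`. For `p > 1` the contour is pushed onto the arc where
`z` is real: this is the curve
`b(φ) = sin (pφ) / sin ((p-1)φ) * exp (iφ)`, `0 < φ < π/p`, together with its complex conjugate.
On it `b - 1 = sin φ / sin ((p-1)φ) * exp (ipφ)`, so that `x = 1 / z = b ^ p / (b - 1)` is positive,
and `A_m` becomes `π⁻¹ ∫ x ^ m Im (b ^ r) (- dx / x)`. The condition `r ≤ p` makes
`Im (b ^ r) = |b| ^ r sin (rφ)` nonnegative, and `x` decreases from `c(p)` to `0` along the arc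
(`logDeriv_sub_nonneg`, `arcRatio_le`). Hence the image under `φ ↦ x` of the measure with density
`- π⁻¹ Im (b ^ r) x' / x` is the required measure, `arcMeasure`.

The contour deformation is replaced by a direct evaluation of the arc integrals
`arcInt p m a = Im ∫ b ^ (a - 1) (b - 1) ^ (-m) db`. Integration by parts (`arcInt_succ`) lowers `m`
down to `m = 1`. For `m = 1` the value is `π` for all `a > 0` (`arcInt_one`): it does not change
when `a` is replaced by `a + 1`, so let `a ≥ 1`; for `a = 1` the integrand is the logarithmic
derivative of `b - 1`, whose argument runs from `0` to `π`; and for `a > 1` the difference to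
`a = 1` is the integral of `(b ^ (a - 1) - 1) / (b - 1)`. The singularity at `1` is removable, so in
the variable `u = log b` this function has a primitive on the strip `|Im u| < π`
(`exists_primitive_expQuot`). That primitive is real on the real axis and its imaginary part tends
to `0` as `Re u → -∞`; so its imaginary part vanishes at the real end `φ = 0` of the arc and in the
limit at the end `b = 0`. The moments of `arcMeasure` are combinations of two arc integrals
(`density_mul_arcRatio_pow`, `arcInt_combination`).

At `p = 1` the measure is the beta distribution with parameters `r` and `1 - r`, or the Dirac mass
at `1` if `r = 1`; at `r = 0` it is the Dirac mass at `0`.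

Uniqueness: the moments grow at most geometrically, so the characteristic function of any measure
that has them is the sum of its Taylor series, hence determined by them (`charFun_eq_tsum`).
-/

open MeasureTheory Set Filter Topology

namespace Raney

/-! ### The arc on which `b ^ p / (b - 1)` is real -/

theorem sinc_pos {x : ℝ} (h0 : 0 ≤ x) (h1 : x < Real.pi) : 0 < Real.sinc x := by
  rcases h0.eq_or_lt with rfl | h
  · simp
  · rw [Real.sinc_of_ne_zero h.ne']
    exact div_pos (Real.sin_pos_of_pos_of_lt_pi h h1) h

/-- The modulus `sin (pφ) / sin ((p-1)φ)` of the point of the arc with argument `φ`. Writing it with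
`sinc` gives it its limiting value at `φ = 0`. -/
noncomputable def rad (p φ : ℝ) : ℝ :=
  p * Real.sinc (p * φ) / ((p - 1) * Real.sinc ((p - 1) * φ))

/-- The distance `sin φ / sin ((p-1)φ)` from `1` to the point of the arc with argument `φ`, written
with `sinc` so that it is continuous at `φ = 0`. -/
noncomputable def gap (p φ : ℝ) : ℝ :=
  Real.sinc φ / ((p - 1) * Real.sinc ((p - 1) * φ))

/-- The logarithmic derivative of `rad p` on `(0, π/p)`. -/
noncomputable def radLogDeriv (p φ : ℝ) : ℝ :=
  p * (Real.cos (p * φ) / Real.sin (p * φ)) -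
    (p - 1) * (Real.cos ((p - 1) * φ) / Real.sin ((p - 1) * φ))

/-- The logarithmic derivative of `gap p` on `(0, π/p)`. -/
noncomputable def gapLogDeriv (p φ : ℝ) : ℝ :=
  Real.cos φ / Real.sin φ - (p - 1) * (Real.cos ((p - 1) * φ) / Real.sin ((p - 1) * φ))

/-- The logarithmic derivative `b' / b` of the arc `b = rad p φ * exp (iφ)`. -/
noncomputable def vel (p φ : ℝ) : ℂ := (radLogDeriv p φ : ℂ) + Complex.I

/-- The power `b ^ a` along the arc, with the branch given by the argument `φ` of `b`. -/
noncomputable def arcPow (p a φ : ℝ) : ℂ :=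
  ((rad p φ ^ a : ℝ) : ℂ) * Complex.exp ((a * φ : ℝ) * Complex.I)

/-- The difference `b - 1` along the arc, in polar form; see `arcPow_one_eq`. -/
noncomputable def arcSub (p φ : ℝ) : ℂ :=
  (gap p φ : ℂ) * Complex.exp ((p * φ : ℝ) * Complex.I)

section Arc

variable {p : ℝ} {φ : ℝ}

theorem lt_pi_of_mem (hp : 1 < p) (hφ : φ ∈ Icc 0 (Real.pi / p)) :
    φ < Real.pi ∧ (p - 1) * φ < Real.pi ∧ p * φ ≤ Real.pi := by
  have hp0 : 0 < p := by linarith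
  have h := (le_div_iff₀ hp0).1 hφ.2
  have hpi := Real.pi_pos
  have h0 := hφ.1
  refine ⟨?_, ?_, by linarith⟩
  · rcases h0.eq_or_lt with rfl | h0
    · exact hpi
    · nlinarith
  · rcases h0.eq_or_lt with rfl | h0
    · simpa using hpi
    · nlinarith

theorem gap_pos (hp : 1 < p) (hφ : φ ∈ Icc 0 (Real.pi / p)) : 0 < gap p φ := by
  obtain ⟨h1, h2, -⟩ := lt_pi_of_mem hp hφ
  have hq : 0 < p - 1 := by linarith
  exact div_pos (sinc_pos hφ.1 h1) (mul_pos hq (sinc_pos (mul_nonneg hq.le hφ.1) h2))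

theorem continuousOn_div_sinc (hp : 1 < p) {f : ℝ → ℝ} (hf : Continuous f) :
    ContinuousOn (fun φ => f φ / ((p - 1) * Real.sinc ((p - 1) * φ))) (Icc 0 (Real.pi / p)) := by
  have hs := Real.continuous_sinc
  refine hf.continuousOn.div (by fun_prop) fun φ hφ => ?_
  have hq : 0 < p - 1 := by linarith
  exact (mul_pos hq (sinc_pos (mul_nonneg hq.le hφ.1) (lt_pi_of_mem hp hφ).2.1)).ne'

theorem continuousOn_gap (hp : 1 < p) : ContinuousOn (gap p) (Icc 0 (Real.pi / p)) :=
  continuousOn_div_sinc hp Real.continuous_sinc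

theorem continuousOn_rad (hp : 1 < p) : ContinuousOn (rad p) (Icc 0 (Real.pi / p)) := by
  have hs := Real.continuous_sinc
  exact continuousOn_div_sinc hp (f := fun φ => p * Real.sinc (p * φ)) (by fun_prop)

theorem sin_pos_of_mem (hp : 1 < p) (hφ : φ ∈ Ioo 0 (Real.pi / p)) :
    0 < Real.sin φ ∧ 0 < Real.sin ((p - 1) * φ) ∧ 0 < Real.sin (p * φ) := by
  have hp0 : 0 < p := by linarith
  obtain ⟨h1, h2, -⟩ := lt_pi_of_mem hp (Ioo_subset_Icc_self hφ)
  have h := (lt_div_iff₀ hp0).1 hφ.2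
  exact ⟨Real.sin_pos_of_pos_of_lt_pi hφ.1 h1,
    Real.sin_pos_of_pos_of_lt_pi (mul_pos (by linarith) hφ.1) h2,
    Real.sin_pos_of_pos_of_lt_pi (mul_pos hp0 hφ.1) (by linarith)⟩

theorem rad_eq (hp : 1 < p) (hφ : φ ≠ 0) :
    rad p φ = Real.sin (p * φ) / Real.sin ((p - 1) * φ) := by
  have hp0 : p ≠ 0 := by linarith
  have hq : p - 1 ≠ 0 := by linarith
  rw [rad, Real.sinc_of_ne_zero (mul_ne_zero hp0 hφ), Real.sinc_of_ne_zero (mul_ne_zero hq hφ)]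
  field_simp

theorem gap_eq (hp : 1 < p) (hφ : φ ≠ 0) :
    gap p φ = Real.sin φ / Real.sin ((p - 1) * φ) := by
  have hq : p - 1 ≠ 0 := by linarith
  rw [gap, Real.sinc_of_ne_zero hφ, Real.sinc_of_ne_zero (mul_ne_zero hq hφ)]
  field_simp

theorem rad_pos (hp : 1 < p) (hφ : φ ∈ Ioo 0 (Real.pi / p)) : 0 < rad p φ := by
  rw [rad_eq hp hφ.1.ne']
  obtain ⟨-, h1, h2⟩ := sin_pos_of_mem hp hφ
  positivity

theorem rad_zero : rad p 0 = p / (p - 1) := by simp [rad]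

theorem gap_zero : gap p 0 = (p - 1)⁻¹ := by simp [gap]

theorem rad_end (hp : 1 < p) : rad p (Real.pi / p) = 0 := by
  have hp0 : p ≠ 0 := by linarith
  rw [rad_eq hp (by positivity), mul_div_cancel₀ _ hp0]
  simp

theorem hasDerivAt_sin_div_sin {c d : ℝ} (hc : Real.sin (c * φ) ≠ 0)
    (hd : Real.sin (d * φ) ≠ 0) :
    HasDerivAt (fun φ => Real.sin (c * φ) / Real.sin (d * φ))
      (Real.sin (c * φ) / Real.sin (d * φ) *
        (c * (Real.cos (c * φ) / Real.sin (c * φ)) -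
          d * (Real.cos (d * φ) / Real.sin (d * φ)))) φ := by
  have h (e : ℝ) : HasDerivAt (fun φ => Real.sin (e * φ)) (Real.cos (e * φ) * e) φ := by
    simpa using ((hasDerivAt_id φ).const_mul e).sin
  convert! (h c).div (h d) hd using 1
  generalize Real.sin (d * φ) = s at *
  field_simp

theorem hasDerivAt_rad (hp : 1 < p) (hφ : φ ∈ Ioo 0 (Real.pi / p)) :
    HasDerivAt (rad p) (rad p φ * radLogDeriv p φ) φ := by
  obtain ⟨-, h1, h2⟩ := sin_pos_of_mem hp hφ
  have h := hasDerivAt_sin_div_sin h2.ne' h1.ne'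
  rw [rad_eq hp hφ.1.ne']
  exact h.congr_of_eventuallyEq ((eventually_ne_nhds hφ.1.ne').mono fun x hx => rad_eq hp hx)

theorem hasDerivAt_gap (hp : 1 < p) (hφ : φ ∈ Ioo 0 (Real.pi / p)) :
    HasDerivAt (gap p) (gap p φ * gapLogDeriv p φ) φ := by
  obtain ⟨h0, h1, -⟩ := sin_pos_of_mem hp hφ
  have h := hasDerivAt_sin_div_sin (φ := φ) (c := 1) (by simpa using h0.ne') h1.ne'
  simp only [one_mul] at h
  rw [gap_eq hp hφ.1.ne']
  exact h.congr_of_eventuallyEq ((eventually_ne_nhds hφ.1.ne').mono fun x hx => gap_eq hp hx)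

theorem radLogDeriv_nonpos (hp : 1 < p) (hφ : φ ∈ Ioo 0 (Real.pi / p)) : radLogDeriv p φ ≤ 0 := by
  obtain ⟨-, h1, h2⟩ := sin_pos_of_mem hp hφ
  -- The numerator over the common denominator vanishes at `0` and is decreasing.
  let N : ℝ → ℝ := fun x => p * (Real.cos (p * x) * Real.sin ((p - 1) * x)) -
    (p - 1) * (Real.cos ((p - 1) * x) * Real.sin (p * x))
  have hN (x : ℝ) :
      HasDerivAt N (-((2 * p - 1) * (Real.sin (p * x) * Real.sin ((p - 1) * x)))) x := by
    have hs (e : ℝ) : HasDerivAt (fun φ => Real.sin (e * φ)) (Real.cos (e * x) * e) x := by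
      simpa using ((hasDerivAt_id x).const_mul e).sin
    have hc (e : ℝ) : HasDerivAt (fun φ => Real.cos (e * φ)) (-Real.sin (e * x) * e) x := by
      simpa using ((hasDerivAt_id x).const_mul e).cos
    convert! (((hc p).mul (hs (p - 1))).const_mul p).sub
      (((hc (p - 1)).mul (hs p)).const_mul (p - 1)) using 1
    ring
  have hanti : AntitoneOn N (Icc 0 (Real.pi / p)) := by
    refine antitoneOn_of_hasDerivWithinAt_nonpos (convex_Icc _ _)
      (fun x _ => (hN x).continuousAt.continuousWithinAt)
      (fun x _ => (hN x).hasDerivWithinAt) fun x hx => ?_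
    rw [interior_Icc] at hx
    obtain ⟨-, h1, h2⟩ := sin_pos_of_mem hp hx
    have : 0 < 2 * p - 1 := by linarith
    rw [Left.neg_nonpos_iff]
    positivity
  have hle := hanti ⟨le_rfl, by positivity⟩ (Ioo_subset_Icc_self hφ) hφ.1.le
  have h0 : N 0 = 0 := by simp [N]
  have : radLogDeriv p φ = N φ / (Real.sin (p * φ) * Real.sin ((p - 1) * φ)) := by
    simp only [radLogDeriv, N]
    generalize Real.sin ((p - 1) * φ) = s at *
    field_simp
  rw [this]
  exact div_nonpos_of_nonpos_of_nonneg (h0 ▸ hle) (by positivity)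

theorem arcPow_one_eq (hp : 1 < p) (hφ : φ ∈ Ioo 0 (Real.pi / p)) :
    arcPow p 1 φ = arcSub p φ + 1 := by
  obtain ⟨h0, h1, h2⟩ := sin_pos_of_mem hp hφ
  rw [arcPow, arcSub, rad_eq hp hφ.1.ne', gap_eq hp hφ.1.ne', Complex.exp_mul_I, Complex.exp_mul_I]
  have e : φ = p * φ - (p - 1) * φ := by ring
  have hs : Real.sin φ = Real.sin (p * φ) * Real.cos ((p - 1) * φ) -
      Real.cos (p * φ) * Real.sin ((p - 1) * φ) := by rw [← Real.sin_sub, ← e]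
  have hc : Real.cos φ = Real.cos (p * φ) * Real.cos ((p - 1) * φ) +
      Real.sin (p * φ) * Real.sin ((p - 1) * φ) := by rw [← Real.cos_sub, ← e]
  have hsc := Real.sin_sq_add_cos_sq (p * φ)
  apply Complex.ext
  · simp [← Complex.ofReal_cos, ← Complex.ofReal_sin, -Complex.ofReal_mul, -Complex.ofReal_div,
      -Complex.ofReal_sub]
    rw [hs, hc]
    generalize Real.sin ((p - 1) * φ) = s at *
    field_simp
    linear_combination s * hsc
  · simp [← Complex.ofReal_cos, ← Complex.ofReal_sin, -Complex.ofReal_mul, -Complex.ofReal_div,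
      -Complex.ofReal_sub]
    field_simp

theorem arcPow_add (hp : 1 < p) (hφ : φ ∈ Ioo 0 (Real.pi / p)) (a b : ℝ) :
    arcPow p (a + b) φ = arcPow p a φ * arcPow p b φ := by
  simp only [arcPow]
  rw [Real.rpow_add (rad_pos hp hφ)]
  have : (((a + b) * φ : ℝ) : ℂ) * Complex.I =
      (a * φ : ℝ) * Complex.I + (b * φ : ℝ) * Complex.I := by
    push_cast; ring
  rw [this, Complex.exp_add]
  push_cast
  ring

theorem arcSub_ne_zero (hp : 1 < p) (hφ : φ ∈ Icc 0 (Real.pi / p)) : arcSub p φ ≠ 0 :=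
  mul_ne_zero (Complex.ofReal_ne_zero.2 (gap_pos hp hφ).ne') (Complex.exp_ne_zero _)

theorem hasDerivAt_arcPow (hp : 1 < p) (hφ : φ ∈ Ioo 0 (Real.pi / p)) (a : ℝ) :
    HasDerivAt (arcPow p a) (a * arcPow p a φ * vel p φ) φ := by
  have hR := rad_pos hp hφ
  have h1 : HasDerivAt (fun x => ((rad p x ^ a : ℝ) : ℂ))
      ((rad p φ ^ a * (a * radLogDeriv p φ) : ℝ) : ℂ) φ := by
    refine HasDerivAt.ofReal_comp ?_
    convert! (hasDerivAt_rad hp hφ).rpow_const (p := a) (Or.inl hR.ne') using 1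
    rw [Real.rpow_sub_one hR.ne']
    field_simp
  have h2 : HasDerivAt (fun x : ℝ => Complex.exp ((a * x : ℝ) * Complex.I))
      (Complex.exp ((a * φ : ℝ) * Complex.I) * (a * Complex.I)) φ := by
    have : HasDerivAt (fun x : ℝ => ((a * x : ℝ) : ℂ)) (a : ℂ) φ := by
      simpa using ((hasDerivAt_id φ).const_mul a).ofReal_comp
    exact (this.mul_const _).cexp
  convert! h1.mul h2 using 1
  simp only [arcPow, vel]
  push_cast
  ring

theorem hasDerivAt_arcSub (hp : 1 < p) (hφ : φ ∈ Ioo 0 (Real.pi / p)) :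
    HasDerivAt (arcSub p) (arcPow p 1 φ * vel p φ) φ := by
  have h := (hasDerivAt_arcPow hp hφ 1).sub_const 1
  simp only [Complex.ofReal_one, one_mul] at h
  refine h.congr_of_eventuallyEq (Filter.eventually_of_mem (Ioo_mem_nhds hφ.1 hφ.2) fun x hx => ?_)
  have := arcPow_one_eq hp hx
  simp only [this]; ring

theorem continuousOn_arcPow (hp : 1 < p) {a : ℝ} (ha : 0 ≤ a) :
    ContinuousOn (arcPow p a) (Icc 0 (Real.pi / p)) := by
  have h := (continuousOn_rad hp).rpow_const (p := a) fun _ _ => Or.inr ha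
  exact (Complex.continuous_ofReal.comp_continuousOn h).mul (by fun_prop)

theorem continuousOn_arcSub (hp : 1 < p) : ContinuousOn (arcSub p) (Icc 0 (Real.pi / p)) :=
  (Complex.continuous_ofReal.comp_continuousOn (continuousOn_gap hp)).mul (by fun_prop)

theorem continuousOn_radLogDeriv (hp : 1 < p) :
    ContinuousOn (radLogDeriv p) (Ioo 0 (Real.pi / p)) := by
  unfold radLogDeriv
  refine ContinuousOn.sub
    (ContinuousOn.mul (by fun_prop) (ContinuousOn.div (by fun_prop) (by fun_prop) ?_))
    (ContinuousOn.mul (by fun_prop) (ContinuousOn.div (by fun_prop) (by fun_prop) ?_))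
  · exact fun x hx => (sin_pos_of_mem hp hx).2.2.ne'
  · exact fun x hx => (sin_pos_of_mem hp hx).2.1.ne'

/-- Up to a bounded term, the norm of `b ^ a * (b' / b)` is a constant times the derivative of the
monotone function `-(rad p φ) ^ a`, which is integrable although `b' / b` is not. -/
theorem integrableOn_arcPow_vel (hp : 1 < p) {a : ℝ} (ha : 0 < a) :
    IntegrableOn (fun φ => arcPow p a φ * vel p φ) (Ioo 0 (Real.pi / p)) := by
  have hc := (continuousOn_rad hp).rpow_const (p := a) fun _ _ => Or.inr ha.le
  have h1 : IntegrableOn (fun φ => -(rad p φ ^ a * (a * radLogDeriv p φ)))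
      (Ioo 0 (Real.pi / p)) := by
    rw [← integrableOn_Ioc_iff_integrableOn_Ioo]
    refine intervalIntegral.integrableOn_deriv_of_nonneg (g := fun φ => -(rad p φ ^ a)) hc.neg ?_ ?_
    · intro x hx
      have hR := rad_pos hp hx
      refine HasDerivAt.fun_neg ?_
      convert! (hasDerivAt_rad hp hx).rpow_const (p := a) (Or.inl hR.ne') using 1
      rw [Real.rpow_sub_one hR.ne']
      field_simp
    · intro x hx
      have hR := rad_pos hp hx
      have := radLogDeriv_nonpos hp hx
      have h2 : 0 ≤ rad p x ^ a * (a * -radLogDeriv p x) := by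
        have : 0 ≤ -radLogDeriv p x := by linarith
        positivity
      linarith
  have h2 : IntegrableOn (fun φ => rad p φ ^ a) (Ioo 0 (Real.pi / p)) :=
    hc.integrableOn_Icc.mono_set Ioo_subset_Icc_self
  refine ((h1.div_const a).add h2).mono' ?_ ?_
  · refine ContinuousOn.aestronglyMeasurable ?_ measurableSet_Ioo
    refine ((continuousOn_arcPow hp ha.le).mono Ioo_subset_Icc_self).mul ?_
    exact (Complex.continuous_ofReal.comp_continuousOn (continuousOn_radLogDeriv hp)).add
      continuousOn_const
  · refine (ae_restrict_iff' measurableSet_Ioo).2 (Eventually.of_forall fun x hx => ?_)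
    have hR := Real.rpow_pos_of_pos (rad_pos hp hx) a
    have hv : ‖vel p x‖ ≤ -radLogDeriv p x + 1 := by
      refine (norm_add_le _ _).trans ?_
      simp [abs_of_nonpos (radLogDeriv_nonpos hp hx)]
    rw [norm_mul, arcPow, norm_mul, Complex.norm_exp_ofReal_mul_I, Complex.norm_real,
      Real.norm_of_nonneg hR.le, mul_one]
    refine (mul_le_mul_of_nonneg_left hv hR.le).trans (le_of_eq ?_)
    simp only [Pi.add_apply]
    field_simp

theorem integrableOn_arcPow_div (hp : 1 < p) {a : ℝ} (ha : 0 < a) (m : ℕ) :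
    IntegrableOn (fun φ => arcPow p a φ * vel p φ / arcSub p φ ^ m) (Ioo 0 (Real.pi / p)) := by
  have h : ContinuousOn (fun φ => (arcSub p φ ^ m)⁻¹) (Icc 0 (Real.pi / p)) :=
    ((continuousOn_arcSub hp).pow m).inv₀ fun x hx => pow_ne_zero _ (arcSub_ne_zero hp hx)
  have h2 := (integrableOn_Icc_iff_integrableOn_Ioo).2 (integrableOn_arcPow_vel hp ha)
  exact (h2.mul_continuousOn h isCompact_Icc).mono_set Ioo_subset_Icc_self

end Arc

/-! ### A primitive of the regularized quotient in logarithmic coordinates -/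

section Strip

/-- The horizontal strip `|Im z| < π`, the image of the slit plane under `log`. -/
def strip : Set ℂ := {z | |z.im| < Real.pi}

theorem isOpen_strip : IsOpen strip :=
  isOpen_lt (Complex.continuous_im.abs) continuous_const

theorem convex_strip : Convex ℝ strip := by
  have : strip = Complex.imLm ⁻¹' (Ioo (-Real.pi) Real.pi) := by
    ext z; simp [strip, abs_lt]
  rw [this]
  exact (convex_Ioo _ _).linear_preimage _

theorem exists_primitive_of_convex {s : Set ℂ} (hs : Convex ℝ s) (hso : IsOpen s) {f : ℂ → ℂ}
    (hf : DifferentiableOn ℂ f s) : ∃ F : ℂ → ℂ, ∀ z ∈ s, HasDerivAt F (f z) z := by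
  let ω : ℂ → ℂ →L[ℂ] ℂ := fun z => ContinuousLinearMap.toSpanSingleton ℂ (f z)
  have hω (z : ℂ) (hz : z ∈ s) : HasFDerivAt ω (((ContinuousLinearMap.toSpanSingletonCLE
      (𝕜 := ℂ) (E := ℂ) : ℂ →L[ℂ] ℂ →L[ℂ] ℂ).restrictScalars ℝ).comp
      ((fderiv ℂ f z).restrictScalars ℝ)) z :=
    (((ContinuousLinearMap.toSpanSingletonCLE (𝕜 := ℂ) (E := ℂ) :
      ℂ →L[ℂ] ℂ →L[ℂ] ℂ).restrictScalars ℝ).hasFDerivAt).comp z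
      ((hf.differentiableAt (hso.mem_nhds hz)).hasFDerivAt.restrictScalars ℝ)
  obtain ⟨F, hF⟩ := hs.exists_forall_hasFDerivAt_of_fderiv_symmetric hso
    (ω := ω) (fun z hz => (hω z hz).differentiableAt.differentiableWithinAt) (by
      intro z hz x y
      rw [(hω z hz).fderiv]
      simp [← toSpanSingleton_deriv]
      ring)
  refine ⟨F, fun z hz => ?_⟩
  simpa [ω] using (hF z hz).hasDerivAt

/-- The function `e ^ z (e ^ (a z) - 1) / (e ^ z - 1)` with its removable singularity at `0` filled
in by writing numerator and denominator as difference quotients. It is `(b ^ a - 1) / (b - 1) db` in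
the variable `z = log b`. -/
noncomputable def expQuot (a : ℝ) (z : ℂ) : ℂ :=
  Complex.exp z * dslope (fun w => Complex.exp (a * w)) 0 z / dslope Complex.exp 0 z

theorem expQuot_of_ne {a : ℝ} {z : ℂ} (hz : z ≠ 0) :
    expQuot a z = Complex.exp z * (Complex.exp (a * z) - 1) / (Complex.exp z - 1) := by
  rw [expQuot, dslope_of_ne _ hz, dslope_of_ne _ hz, slope_def_field, slope_def_field]
  simp
  field_simp

theorem expQuot_zero (a : ℝ) : expQuot a 0 = a := by
  have h : HasDerivAt (fun w : ℂ => Complex.exp (a * w)) a 0 := by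
    simpa using ((hasDerivAt_id (0 : ℂ)).const_mul (a : ℂ)).cexp
  simp [expQuot, h.deriv]

theorem exp_sub_one_ne_zero {z : ℂ} (hz : z ∈ strip) (h0 : z ≠ 0) : Complex.exp z - 1 ≠ 0 := by
  intro h
  obtain ⟨n, hn⟩ := Complex.exp_eq_one_iff.1 (sub_eq_zero.1 h)
  have him : z.im = n * (2 * Real.pi) := by simp [hn]
  have hz' : |(n : ℝ)| * (2 * Real.pi) < Real.pi := by
    have : |z.im| < Real.pi := hz
    rwa [him, abs_mul, abs_of_pos Real.two_pi_pos] at this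
  have : |(n : ℝ)| < 1 := by
    have := Real.pi_pos
    by_contra hc
    nlinarith
  have hn0 : n = 0 := by
    have h2 : |n| < 1 := by exact_mod_cast this
    exact Int.abs_lt_one_iff.1 h2
  exact h0 (by simp [hn, hn0])

theorem differentiableOn_expQuot (a : ℝ) : DifferentiableOn ℂ (expQuot a) strip := by
  have h1 : DifferentiableOn ℂ (dslope (fun w : ℂ => Complex.exp (a * w)) 0) univ :=
    (Complex.differentiableOn_dslope univ_mem).2 (by fun_prop)
  have h2 : DifferentiableOn ℂ (dslope Complex.exp 0) univ :=
    (Complex.differentiableOn_dslope univ_mem).2 (by fun_prop)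
  refine ((Complex.differentiable_exp.differentiableOn.mul (h1.mono (subset_univ _)))).div
    (h2.mono (subset_univ _)) fun z hz => ?_
  by_cases h0 : z = 0
  · simp [h0]
  · rw [dslope_of_ne _ h0, slope_def_field]
    simpa using ⟨exp_sub_one_ne_zero hz h0, h0⟩

theorem expQuot_ofReal_im (a x : ℝ) : (expQuot a x).im = 0 := by
  by_cases hx : x = 0
  · simp [hx, expQuot_zero]
  · rw [expQuot_of_ne (Complex.ofReal_ne_zero.2 hx)]
    have : Complex.exp (x : ℂ) * (Complex.exp (a * x) - 1) / (Complex.exp x - 1) =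
      ((Real.exp x * (Real.exp (a * x) - 1) / (Real.exp x - 1) : ℝ) : ℂ) := by push_cast; rfl
    rw [this, Complex.ofReal_im]

theorem norm_expQuot_le {a x : ℝ} (ha : 0 < a) (hx : x < 0) {z : ℂ} (hz : z.re ≤ x) :
    ‖expQuot a z‖ ≤ 2 * Real.exp x / (1 - Real.exp x) := by
  have h0 : z ≠ 0 := by rintro rfl; simp at hz; linarith
  have he : Real.exp x < 1 := by simpa using hx
  have hez : Real.exp z.re ≤ Real.exp x := Real.exp_le_exp.2 hz
  have h1 : ‖Complex.exp (a * z) - 1‖ ≤ 2 := by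
    refine (norm_sub_le _ _).trans ?_
    have : Real.exp (a * z.re) ≤ 1 := by
      rw [Real.exp_le_one_iff]; exact mul_nonpos_of_nonneg_of_nonpos ha.le (by linarith)
    simp only [Complex.norm_exp, norm_one]
    simp
    linarith
  have h2 : 1 - Real.exp x ≤ ‖Complex.exp z - 1‖ := by
    have := norm_sub_norm_le (1 : ℂ) (Complex.exp z)
    rw [norm_one, Complex.norm_exp, norm_sub_rev] at this
    linarith
  rw [expQuot_of_ne h0, norm_div, norm_mul, Complex.norm_exp]
  have : Real.exp z.re * ‖Complex.exp (a * z) - 1‖ ≤ 2 * Real.exp x := by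
    nlinarith [Real.exp_pos z.re, norm_nonneg (Complex.exp (a * z) - 1)]
  exact div_le_div₀ (by positivity) this (by linarith) h2

/-- The bound on `Im F` comes from comparing `z` with `Re z`, where `F` is real. -/
theorem exists_primitive_expQuot {a : ℝ} (ha : 0 < a) :
    ∃ F : ℂ → ℂ, (∀ z ∈ strip, HasDerivAt F (expQuot a z) z) ∧ (∀ x : ℝ, (F x).im = 0) ∧
      ∀ z ∈ strip, z.re < 0 →
        |(F z).im| ≤ 2 * Real.exp z.re / (1 - Real.exp z.re) * Real.pi := by
  obtain ⟨F₀, hF₀⟩ := exists_primitive_of_convex convex_strip isOpen_strip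
    (differentiableOn_expQuot a)
  have hreal (x : ℝ) : (x : ℂ) ∈ strip := by simp [strip, Real.pi_pos]
  -- Normalizing by `F 0 = 0` makes the primitive real on the real axis.
  let F : ℂ → ℂ := fun z => F₀ z - F₀ 0
  have hF (z) (hz : z ∈ strip) : HasDerivAt F (expQuot a z) z := (hF₀ z hz).sub_const _
  have him (x : ℝ) : (F x).im = 0 := by
    have hd (y : ℝ) : HasDerivAt (fun y : ℝ => (F y).im) 0 y := by
      have h := (hF y (hreal y)).comp_ofReal
      have h2 : HasDerivAt (fun y : ℝ => (F y).im) (expQuot a y).im y :=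
        Complex.imCLM.hasFDerivAt.comp_hasDerivAt y h
      rwa [expQuot_ofReal_im] at h2
    have := is_const_of_deriv_eq_zero (fun y => (hd y).differentiableAt) (fun y => (hd y).deriv) x 0
    simpa [F] using this
  refine ⟨F, hF, him, fun z hz hre => ?_⟩
  have hconv : Convex ℝ (strip ∩ {w : ℂ | w.re ≤ z.re}) :=
    convex_strip.inter (convex_halfSpace_re_le _)
  have hb := hconv.norm_image_sub_le_of_norm_hasDerivWithin_le
    (fun w hw => (hF w hw.1).hasDerivWithinAt) (fun w hw => norm_expQuot_le ha hre hw.2)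
    (x := (z.re : ℂ)) (y := z) ⟨hreal _, by simp⟩ ⟨hz, le_refl z.re⟩
  have h1 : |(F z).im| ≤ ‖F z - F z.re‖ := by
    simpa [him] using Complex.abs_im_le_norm (F z - F z.re)
  have he : Real.exp z.re < 1 := by simpa using hre
  have h2 : ‖z - z.re‖ ≤ Real.pi := by
    have : z - z.re = z.im * Complex.I := by
      apply Complex.ext <;> simp
    rw [this, norm_mul, Complex.norm_I, mul_one, Complex.norm_real]
    exact le_of_lt hz
  have h3 : 0 ≤ 2 * Real.exp z.re / (1 - Real.exp z.re) :=
    div_nonneg (by positivity) (by linarith)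
  exact (h1.trans hb).trans (mul_le_mul_of_nonneg_left h2 h3)

end Strip

/-! ### Evaluation of the arc integrals -/

/-- The imaginary part of `∫ b ^ (a - 1) (b - 1) ^ (-m) db` along the arc. -/
noncomputable def arcInt (p : ℝ) (m : ℕ) (a : ℝ) : ℝ :=
  ∫ φ in (0)..(Real.pi / p), (arcPow p a φ * vel p φ / arcSub p φ ^ m).im

section ArcInt

variable {p : ℝ}

theorem intervalIntegrable_arc (hp : 1 < p) {a : ℝ} (ha : 0 < a) (m : ℕ) :
    IntervalIntegrable (fun φ => (arcPow p a φ * vel p φ / arcSub p φ ^ m).im) volume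
      0 (Real.pi / p) := by
  rw [intervalIntegrable_iff_integrableOn_Ioo_of_le (by positivity)]
  exact (integrableOn_arcPow_div hp ha m).im

theorem arcPow_end (hp : 1 < p) {a : ℝ} (ha : 0 < a) : arcPow p a (Real.pi / p) = 0 := by
  simp [arcPow, rad_end hp, Real.zero_rpow ha.ne']

/-- Integration by parts. The boundary terms vanish, since `b ^ a (b - 1) ^ (-m)` is real at `φ = 0`
and zero at `φ = π/p`. -/
theorem arcInt_succ (hp : 1 < p) {a : ℝ} (ha : 0 < a) (m : ℕ) :
    m * arcInt p (m + 1) (a + 1) = a * arcInt p m a := by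
  have hd (φ) (hφ : φ ∈ Ioo 0 (Real.pi / p)) :
      HasDerivAt (fun φ => (arcPow p a φ / arcSub p φ ^ m).im)
        (a * (arcPow p a φ * vel p φ / arcSub p φ ^ m).im -
          m * (arcPow p (a + 1) φ * vel p φ / arcSub p φ ^ (m + 1)).im) φ := by
    have hw := arcSub_ne_zero hp (Ioo_subset_Icc_self hφ)
    have h := (hasDerivAt_arcPow hp hφ a).div ((hasDerivAt_arcSub hp hφ).pow m) (pow_ne_zero m hw)
    have h2 := Complex.imCLM.hasFDerivAt.comp_hasDerivAt φ h
    convert! h2 using 1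
    rw [← Complex.im_ofReal_mul, ← Complex.im_ofReal_mul, ← Complex.sub_im, Complex.imCLM_apply]
    congr 1
    rw [arcPow_add hp hφ]
    rcases m with _ | m
    · simp [mul_assoc]
    · simp only [Nat.add_sub_cancel, Pi.pow_apply]
      push_cast
      field_simp
      ring
  have hc : ContinuousOn (fun φ => (arcPow p a φ / arcSub p φ ^ m).im) (Icc 0 (Real.pi / p)) :=
    Complex.continuous_im.comp_continuousOn ((continuousOn_arcPow hp ha.le).div
      ((continuousOn_arcSub hp).pow m) fun x hx => pow_ne_zero _ (arcSub_ne_zero hp hx))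
  have i1 := (intervalIntegrable_arc hp ha m).const_mul a
  have i2 := (intervalIntegrable_arc hp (by linarith : 0 < a + 1) (m + 1)).const_mul (m : ℝ)
  have h := intervalIntegral.integral_eq_sub_of_hasDerivAt_of_le (by positivity) hc hd (i1.sub i2)
  rw [intervalIntegral.integral_sub i1 i2, intervalIntegral.integral_const_mul,
    intervalIntegral.integral_const_mul] at h
  have e0 : (arcPow p a 0 / arcSub p 0 ^ m).im = 0 := by
    have : arcPow p a 0 / arcSub p 0 ^ m = ((rad p 0 ^ a / gap p 0 ^ m : ℝ) : ℂ) := by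
      simp [arcPow, arcSub]
    rw [this, Complex.ofReal_im]
  rw [e0, arcPow_end hp ha] at h
  simp only [zero_div, Complex.zero_im, sub_zero] at h
  simp only [arcInt]
  linarith

theorem arcInt_zero (hp : 1 < p) {a : ℝ} (ha : 0 < a) : arcInt p 0 a = 0 := by
  have := arcInt_succ hp ha 0
  simpa [ha.ne'] using this

theorem arcInt_one_add_one (hp : 1 < p) {a : ℝ} (ha : 0 < a) :
    arcInt p 1 (a + 1) = arcInt p 1 a := by
  -- This is `b ^ (a + 1) / (b - 1) = b ^ a + b ^ a / (b - 1)`.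
  have h : arcInt p 1 (a + 1) = arcInt p 0 a + arcInt p 1 a := by
    simp only [arcInt]
    rw [← intervalIntegral.integral_add (intervalIntegrable_arc hp ha 0)
      (intervalIntegrable_arc hp ha 1), intervalIntegral.integral_of_le (by positivity),
      intervalIntegral.integral_of_le (by positivity), integral_Ioc_eq_integral_Ioo,
      integral_Ioc_eq_integral_Ioo]
    refine setIntegral_congr_fun measurableSet_Ioo fun φ hφ => ?_
    have hw := arcSub_ne_zero hp (Ioo_subset_Icc_self hφ)
    rw [arcPow_add hp hφ, arcPow_one_eq hp hφ, ← Complex.add_im]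
    congr 1
    field_simp
  rw [h, arcInt_zero hp ha, zero_add]

theorem arcPow_one_mul_vel_div (hp : 1 < p) {φ : ℝ} (hφ : φ ∈ Ioo 0 (Real.pi / p)) :
    arcPow p 1 φ * vel p φ / arcSub p φ = gapLogDeriv p φ + p * Complex.I := by
  have hg : (gap p φ : ℂ) ≠ 0 :=
    Complex.ofReal_ne_zero.2 (gap_pos hp (Ioo_subset_Icc_self hφ)).ne'
  have h2 : HasDerivAt (fun x : ℝ => Complex.exp ((p * x : ℝ) * Complex.I))
      (Complex.exp ((p * φ : ℝ) * Complex.I) * (p * Complex.I)) φ := by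
    have : HasDerivAt (fun x : ℝ => ((p * x : ℝ) : ℂ)) (p : ℂ) φ := by
      simpa using ((hasDerivAt_id φ).const_mul p).ofReal_comp
    exact (this.mul_const _).cexp
  have h3 := ((hasDerivAt_gap hp hφ).ofReal_comp.mul h2).unique (hasDerivAt_arcSub hp hφ)
  rw [← h3, arcSub, div_eq_iff (mul_ne_zero hg (Complex.exp_ne_zero _))]
  push_cast
  ring

theorem arcInt_one_one (hp : 1 < p) : arcInt p 1 1 = Real.pi := by
  have hp0 : p ≠ 0 := by linarith
  have h : arcInt p 1 1 = ∫ _ in (0)..(Real.pi / p), p := by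
    simp only [arcInt]
    rw [intervalIntegral.integral_of_le (by positivity),
      intervalIntegral.integral_of_le (by positivity), integral_Ioc_eq_integral_Ioo,
      integral_Ioc_eq_integral_Ioo]
    refine setIntegral_congr_fun measurableSet_Ioo fun φ hφ => ?_
    rw [pow_one, arcPow_one_mul_vel_div hp hφ]
    simp
  rw [h]
  simp
  field_simp

/-- The difference of the two sides is the integral of `(b ^ a - 1) / (b - 1) db`, whose primitive
has imaginary part zero at both ends of the arc. -/
theorem arcInt_one_add (hp : 1 < p) {a : ℝ} (ha : 0 < a) :
    arcInt p 1 (a + 1) = arcInt p 1 1 := by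
  obtain ⟨F, hF, hFre, hFb⟩ := exists_primitive_expQuot ha
  -- The arc in the coordinate `log b`.
  let u : ℝ → ℂ := fun φ => (Real.log (rad p φ) : ℂ) + φ * Complex.I
  have hpos : 0 < Real.pi / p := by positivity
  have hlt : Real.pi / p < Real.pi := div_lt_self Real.pi_pos hp
  have hstrip (φ : ℝ) (h0 : 0 ≤ φ) (h1 : φ ≤ Real.pi / p) : u φ ∈ strip := by
    simp only [strip, u, mem_ofPred_eq]
    simp only [Complex.add_im, Complex.ofReal_im, Complex.im_ofReal_mul,
      Complex.I_im, mul_one, zero_add]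
    rw [abs_of_nonneg h0]; linarith
  have hu (φ) (hφ : φ ∈ Ioo 0 (Real.pi / p)) : HasDerivAt u (vel p φ) φ := by
    have hR := rad_pos hp hφ
    have h1 := ((hasDerivAt_rad hp hφ).log hR.ne').ofReal_comp
    have h2 := ((hasDerivAt_id φ).ofReal_comp).mul_const Complex.I
    convert! h1.add h2 using 1
    rw [mul_div_cancel_left₀ _ hR.ne']
    simp [vel]
  have hexp (φ) (hφ : φ ∈ Ioo 0 (Real.pi / p)) (b : ℝ) :
      Complex.exp (b * u φ) = arcPow p b φ := by
    have hR := rad_pos hp hφ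
    simp only [u, arcPow]
    rw [Real.rpow_def_of_pos hR, mul_add, Complex.exp_add]
    push_cast
    ring_nf
  have hq (φ) (hφ : φ ∈ Ioo 0 (Real.pi / p)) : (expQuot a (u φ) * vel p φ).im =
      (arcPow p (a + 1) φ * vel p φ / arcSub p φ ^ 1).im -
        (arcPow p 1 φ * vel p φ / arcSub p φ ^ 1).im := by
    have h0 : u φ ≠ 0 := by
      intro h
      have := congrArg Complex.im h
      simp [u] at this
      exact hφ.1.ne' this
    have h1 := hexp φ hφ 1
    rw [Complex.ofReal_one, one_mul] at h1
    have hw := arcSub_ne_zero hp (Ioo_subset_Icc_self hφ)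
    rw [expQuot_of_ne h0, hexp φ hφ a, h1, arcPow_add hp hφ, ← Complex.sub_im,
      show arcPow p 1 φ - 1 = arcSub p φ by rw [arcPow_one_eq hp hφ]; ring]
    congr 1
    field_simp
  have i1 := intervalIntegrable_arc hp (by linarith : 0 < a + 1) 1
  have i2 := intervalIntegrable_arc hp one_pos 1
  have hd (φ) (hφ : φ ∈ Ioo 0 (Real.pi / p)) : HasDerivAt (fun φ => (F (u φ)).im)
      ((arcPow p (a + 1) φ * vel p φ / arcSub p φ ^ 1).im -
        (arcPow p 1 φ * vel p φ / arcSub p φ ^ 1).im) φ := by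
    rw [← hq φ hφ]
    have h := (hF (u φ) (hstrip φ hφ.1.le hφ.2.le)).comp φ (hu φ hφ)
    exact Complex.imCLM.hasFDerivAt.comp_hasDerivAt φ h
  have hcR := continuousOn_rad hp
  have ht0 : Tendsto (fun φ => (F (u φ)).im) (𝓝[>] 0) (𝓝 0) := by
    have hR0 : rad p 0 ≠ 0 := by
      rw [rad_zero]
      exact (div_pos (by linarith) (by linarith)).ne'
    have hc : ContinuousWithinAt u (Ioi 0) 0 := by
      have h1 : ContinuousWithinAt (rad p) (Ioi 0) 0 :=
        (hcR 0 ⟨le_rfl, hpos.le⟩).mono_of_mem_nhdsWithin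
          (mem_of_superset (Ioo_mem_nhdsGT hpos) Ioo_subset_Icc_self)
      exact (Complex.continuous_ofReal.continuousAt.comp_continuousWithinAt (h1.log hR0)).add
        (by fun_prop)
    have h2 := (Complex.continuous_im.continuousAt.comp
      (hF (u 0) (hstrip 0 le_rfl hpos.le)).continuousAt).comp_continuousWithinAt hc
    have h3 : (F (u 0)).im = 0 := by simpa [u] using hFre (Real.log (rad p 0))
    simpa [ContinuousWithinAt, Function.comp_def, h3] using h2
  have ht1 : Tendsto (fun φ => (F (u φ)).im) (𝓝[<] (Real.pi / p)) (𝓝 0) := by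
    have hR : Tendsto (rad p) (𝓝[<] (Real.pi / p)) (𝓝 0) := by
      have h1 := (hcR _ ⟨hpos.le, le_rfl⟩).mono_of_mem_nhdsWithin
          (mem_of_superset (Ioo_mem_nhdsLT hpos) Ioo_subset_Icc_self)
      simpa [ContinuousWithinAt, rad_end hp] using h1
    have hB : Tendsto (fun φ => 2 * rad p φ / (1 - rad p φ) * Real.pi) (𝓝[<] (Real.pi / p))
        (𝓝 0) := by
      have := ((hR.const_mul 2).div (hR.const_sub 1) (by simp)).mul_const Real.pi
      simpa using this
    refine squeeze_zero_norm' ?_ hB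
    filter_upwards [Ioo_mem_nhdsLT hpos, hR.eventually_lt_const one_pos] with φ hφ h1
    have hr := rad_pos hp hφ
    have hre : (u φ).re = Real.log (rad p φ) := by simp [u]
    have := hFb (u φ) (hstrip φ hφ.1.le hφ.2.le) (by rw [hre]; exact Real.log_neg hr h1)
    rwa [hre, Real.exp_log hr] at this
  have h := intervalIntegral.integral_eq_sub_of_hasDerivAt_of_tendsto hpos hd (i1.sub i2) ht0 ht1
  rw [intervalIntegral.integral_sub i1 i2, sub_zero] at h
  exact sub_eq_zero.1 h

theorem arcInt_one (hp : 1 < p) {a : ℝ} (ha : 0 < a) : arcInt p 1 a = Real.pi := by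
  rw [← arcInt_one_add_one hp ha, arcInt_one_add hp ha, arcInt_one_one hp]

theorem arcInt_eq (hp : 1 < p) (m : ℕ) : ∀ {a : ℝ}, (m : ℝ) < a → arcInt p (m + 1) a =
    Real.pi / m.factorial * ∏ i ∈ Finset.Ico 1 (m + 1), (a - i) := by
  induction m with
  | zero =>
    intro a ha
    simpa using arcInt_one hp (by simpa using ha)
  | succ m ih =>
    intro a ha
    push_cast at ha
    have hm : (0 : ℝ) ≤ m := m.cast_nonneg
    have h := arcInt_succ hp (by linarith : 0 < a - 1) (m + 1)
    rw [sub_add_cancel, ih (by linarith)] at h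
    have hm1 : ((m + 1 : ℕ) : ℝ) ≠ 0 := by positivity
    rw [← mul_right_inj' hm1, h, Finset.prod_Ico_eq_prod_range, Finset.prod_Ico_eq_prod_range,
      Nat.add_sub_cancel, Nat.add_sub_cancel, Finset.prod_range_succ', Nat.factorial_succ]
    have : ∀ k : ℕ, a - 1 - ((1 + k : ℕ) : ℝ) = a - ((1 + (k + 1) : ℕ) : ℝ) := by
      intro k; push_cast; ring
    simp only [this]
    push_cast at hm1 ⊢
    field_simp

end ArcInt

/-! ### Measures determined by their moments -/

section Moments

theorem integrable_and_integral_abs_pow_le {μ : Measure ℝ} [IsProbabilityMeasure μ] {a : ℕ → ℝ}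
    {C : ℝ} (h : IsMomentSequenceOf a μ) (hC : ∀ m, a m ≤ C ^ m) (n : ℕ) :
    Integrable (fun x : ℝ => |x| ^ n) μ ∧ ∫ x, |x| ^ n ∂μ ≤ 1 + (C ^ 2) ^ n := by
  have h2 := h (2 * n)
  have hle (x : ℝ) : |x| ^ n ≤ 1 + x ^ (2 * n) := by
    rw [pow_mul, ← sq_abs, pow_right_comm]
    nlinarith [sq_nonneg (|x| ^ n - 1)]
  have hi : Integrable (fun x : ℝ => 1 + x ^ (2 * n)) μ := (integrable_const 1).add h2.1
  have hint : Integrable (fun x : ℝ => |x| ^ n) μ := by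
    simpa [abs_pow] using (h n).1.abs
  refine ⟨hint, (integral_mono hint hi hle).trans ?_⟩
  rw [integral_add (integrable_const 1) h2.1, h2.2, ← pow_mul]
  simpa using hC (2 * n)

theorem charFun_eq_tsum {μ : Measure ℝ} [IsProbabilityMeasure μ] {a : ℕ → ℝ} {C : ℝ}
    (h : IsMomentSequenceOf a μ) (hC : ∀ m, a m ≤ C ^ m) (t : ℝ) :
    charFun μ t = ∑' n : ℕ, (t * Complex.I) ^ n / n.factorial * a n := by
  let F : ℕ → ℝ → ℂ := fun n x => (t * Complex.I) ^ n / n.factorial * ((x ^ n : ℝ) : ℂ)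
  have hFi (n : ℕ) : Integrable (F n) μ := (h n).1.ofReal.const_mul _
  have hFn (n : ℕ) (x : ℝ) : ‖F n x‖ = |t| ^ n / n.factorial * |x| ^ n := by simp [F]
  have hsum : Summable fun n => ∫ x, ‖F n x‖ ∂μ := by
    have hs : Summable fun n : ℕ =>
        |t| ^ n / n.factorial + (|t| * C ^ 2) ^ n / n.factorial :=
      (Real.summable_pow_div_factorial _).add (Real.summable_pow_div_factorial _)
    refine Summable.of_nonneg_of_le (fun n => integral_nonneg fun x => norm_nonneg _)
      (fun n => ?_) hs
    simp only [hFn]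
    rw [integral_const_mul]
    refine (mul_le_mul_of_nonneg_left (integrable_and_integral_abs_pow_le h hC n).2
      (by positivity)).trans (le_of_eq ?_)
    rw [mul_pow]
    ring
  have hS := hasSum_integral_of_summable_integral_norm hFi hsum
  have hexp (x : ℝ) : ∑' n, F n x = Complex.exp (t * x * Complex.I) := by
    have := (NormedSpace.expSeries_div_hasSum_exp (t * x * Complex.I : ℂ)).tsum_eq
    rw [Complex.exp_eq_exp_ℂ, ← this]
    refine tsum_congr fun n => ?_
    simp only [F]
    push_cast
    ring
  simp only [hexp] at hS
  rw [charFun_apply_real, ← hS.tsum_eq]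
  refine tsum_congr fun n => ?_
  simp only [F]
  rw [integral_const_mul, integral_complex_ofReal, (h n).2]

/-- Measures with the same, geometrically bounded, moments are equal. -/
theorem eq_of_isMomentSequenceOf {μ ν : Measure ℝ} [IsProbabilityMeasure μ]
    [IsProbabilityMeasure ν] {a : ℕ → ℝ} {C : ℝ} (hμ : IsMomentSequenceOf a μ)
    (hν : IsMomentSequenceOf a ν) (hC : ∀ m, a m ≤ C ^ m) : ν = μ :=
  Measure.ext_of_charFun (funext fun t => by
    rw [charFun_eq_tsum hμ hC, charFun_eq_tsum hν hC])

theorem exists_unique_of_ae_mem_Icc {μ : Measure ℝ} [IsProbabilityMeasure μ] {a : ℕ → ℝ} {c : ℝ}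
    (hc : ∀ᵐ x ∂μ, x ∈ Icc 0 c) (ha : ∀ m, ∫ x, x ^ m ∂μ = a m) :
    ∃ μ : Measure ℝ, IsProbabilityMeasure μ ∧ μ.support ⊆ Icc 0 c ∧ IsMomentSequenceOf a μ ∧
      ∀ ν : Measure ℝ, IsProbabilityMeasure ν → IsMomentSequenceOf a ν → ν = μ := by
  have hb (m : ℕ) : ∀ᵐ x ∂μ, x ^ m ∈ Icc 0 (c ^ m) := hc.mono fun x hx =>
    ⟨pow_nonneg hx.1 m, pow_le_pow_left₀ hx.1 hx.2 m⟩
  have hi (m : ℕ) : Integrable (fun x : ℝ => x ^ m) μ :=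
    Integrable.of_mem_Icc 0 (c ^ m) (by fun_prop) (hb m)
  have hμ : IsMomentSequenceOf a μ := fun m => ⟨hi m, ha m⟩
  refine ⟨μ, inferInstance, Measure.support_subset_of_isClosed isClosed_Icc hc, hμ,
    fun ν hν hν' => eq_of_isMomentSequenceOf hμ hν' (C := c) fun m => ?_⟩
  rw [← ha]
  refine (integral_mono_ae (hi m) (integrable_const (c ^ m))
    ((hb m).mono fun x hx => hx.2)).trans ?_
  simp

end Moments

/-! ### The measure for `p > 1` -/

section Density

variable {p r φ : ℝ}

/-- The real number `b ^ p / (b - 1)` at the point of the arc with argument `φ`. -/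
noncomputable def arcRatio (p φ : ℝ) : ℝ := rad p φ ^ p / gap p φ

/-- The density `-π⁻¹ Im (b ^ r) x' / x`, where `x = arcRatio p φ`, with respect to `dφ`. -/
noncomputable def density (p r φ : ℝ) : ℝ :=
  rad p φ ^ r * Real.sin (r * φ) * (gapLogDeriv p φ - p * radLogDeriv p φ) / Real.pi

theorem measurable_arcRatio (p : ℝ) : Measurable (arcRatio p) := by
  have := Real.continuous_sinc.measurable
  unfold arcRatio rad gap
  fun_prop

theorem measurable_density (p r : ℝ) : Measurable (density p r) := by
  have := Real.continuous_sinc.measurable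
  unfold density rad gapLogDeriv radLogDeriv
  fun_prop

/-- The quantity is `-x' / x` for `x = arcRatio p φ`. Over a common denominator it is a sum of two
squares. -/
theorem logDeriv_sub_nonneg (hp : 1 < p) (hφ : φ ∈ Ioo 0 (Real.pi / p)) :
    0 ≤ gapLogDeriv p φ - p * radLogDeriv p φ := by
  obtain ⟨h0, h1, h2⟩ := sin_pos_of_mem hp hφ
  have e : p * φ = φ + (p - 1) * φ := by ring
  have hs : Real.sin (p * φ) = Real.sin φ * Real.cos ((p - 1) * φ) +
      Real.cos φ * Real.sin ((p - 1) * φ) := by rw [← Real.sin_add, ← e]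
  have hc : Real.cos (p * φ) = Real.cos φ * Real.cos ((p - 1) * φ) -
      Real.sin φ * Real.sin ((p - 1) * φ) := by rw [← Real.cos_add, ← e]
  unfold gapLogDeriv radLogDeriv
  rw [hc]
  rw [hs] at h2 ⊢
  generalize Real.sin φ = s at *
  generalize Real.cos φ = c at *
  generalize Real.sin ((p - 1) * φ) = S at *
  generalize Real.cos ((p - 1) * φ) = C at *
  have key : c / s - (p - 1) * (C / S) -
      p * (p * ((c * C - s * S) / (s * C + c * S)) - (p - 1) * (C / S)) =
      ((c * S - (p - 1) * C * s) ^ 2 + (p * s * S) ^ 2) / (s * S * (s * C + c * S)) := by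
    have := h2.ne'
    field_simp
    ring
  rw [key]
  positivity

theorem density_nonneg (hp : 1 < p) (hr : 0 ≤ r) (hrp : r ≤ p) (hφ : φ ∈ Ioo 0 (Real.pi / p)) :
    0 ≤ density p r φ := by
  have h1 := logDeriv_sub_nonneg hp hφ
  have h2 := rad_pos hp hφ
  have h3 : 0 ≤ Real.sin (r * φ) := Real.sin_nonneg_of_nonneg_of_le_pi (mul_nonneg hr hφ.1.le)
    ((mul_le_mul_of_nonneg_right hrp hφ.1.le).trans
      (lt_pi_of_mem hp (Ioo_subset_Icc_self hφ)).2.2)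
  have := Real.pi_pos
  unfold density
  positivity

theorem hasDerivAt_arcRatio (hp : 1 < p) (hφ : φ ∈ Ioo 0 (Real.pi / p)) :
    HasDerivAt (arcRatio p) (-(arcRatio p φ * (gapLogDeriv p φ - p * radLogDeriv p φ))) φ := by
  have hR := rad_pos hp hφ
  have hg := gap_pos hp (Ioo_subset_Icc_self hφ)
  convert! ((hasDerivAt_rad hp hφ).rpow_const (p := p) (Or.inl hR.ne')).div
    (hasDerivAt_gap hp hφ) hg.ne' using 1
  rw [Real.rpow_sub_one hR.ne', arcRatio]
  field_simp
  ring

theorem arcRatio_nonneg (hp : 1 < p) (hφ : φ ∈ Ioo 0 (Real.pi / p)) : 0 ≤ arcRatio p φ :=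
  div_nonneg (Real.rpow_nonneg (rad_pos hp hφ).le _) (gap_pos hp (Ioo_subset_Icc_self hφ)).le

theorem arcRatio_zero (hp : 1 < p) : arcRatio p 0 = raneyBound p := by
  have hq : 0 < p - 1 := by linarith
  rw [arcRatio, rad_zero, gap_zero, raneyBound, Real.div_rpow (by linarith) hq.le,
    Real.rpow_sub_one hq.ne']
  have := Real.rpow_pos_of_pos hq p
  field_simp

theorem arcRatio_le (hp : 1 < p) (hφ : φ ∈ Ioo 0 (Real.pi / p)) : arcRatio p φ ≤ raneyBound p := by
  have hc : ContinuousOn (arcRatio p) (Icc 0 (Real.pi / p)) :=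
    ((continuousOn_rad hp).rpow_const fun _ _ => Or.inr (by linarith)).div (continuousOn_gap hp)
      fun x hx => (gap_pos hp hx).ne'
  have hanti : AntitoneOn (arcRatio p) (Icc 0 (Real.pi / p)) := by
    refine antitoneOn_of_hasDerivWithinAt_nonpos (convex_Icc _ _) hc
      (fun x hx => (hasDerivAt_arcRatio hp (by rwa [interior_Icc] at hx)).hasDerivWithinAt)
      fun x hx => ?_
    rw [interior_Icc] at hx
    exact neg_nonpos.2 (mul_nonneg (arcRatio_nonneg hp hx) (logDeriv_sub_nonneg hp hx))
  rw [← arcRatio_zero hp]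
  exact hanti ⟨le_rfl, by positivity⟩ (Ioo_subset_Icc_self hφ) hφ.1.le

theorem arcPow_self_div (hp : 1 < p) (hφ : φ ∈ Ioo 0 (Real.pi / p)) (m : ℕ) :
    arcPow p (m * p) φ / arcSub p φ ^ m = ((arcRatio p φ ^ m : ℝ) : ℂ) := by
  induction m with
  | zero => simp [arcPow]
  | succ m ih =>
    have hg : (gap p φ : ℂ) ≠ 0 :=
      Complex.ofReal_ne_zero.2 (gap_pos hp (Ioo_subset_Icc_self hφ)).ne'
    have h1 : arcPow p p φ / arcSub p φ = (arcRatio p φ : ℂ) := by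
      rw [div_eq_iff (arcSub_ne_zero hp (Ioo_subset_Icc_self hφ)), arcPow, arcSub, arcRatio]
      push_cast
      field_simp
    have : ((m + 1 : ℕ) : ℝ) * p = m * p + p := by push_cast; ring
    rw [this, arcPow_add hp hφ, pow_succ, mul_div_mul_comm, ih, h1]
    push_cast
    ring

theorem density_mul_arcRatio_pow (hp : 1 < p) (hφ : φ ∈ Ioo 0 (Real.pi / p)) (m : ℕ) :
    density p r φ * arcRatio p φ ^ m =
      ((arcPow p (m * p + r + 1) φ * vel p φ / arcSub p φ ^ (m + 1)).im -
        p * (arcPow p (m * p + r) φ * vel p φ / arcSub p φ ^ m).im) / Real.pi := by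
  have hw := arcSub_ne_zero hp (Ioo_subset_Icc_self hφ)
  have hm := arcPow_self_div hp hφ m
  have h1 := arcPow_one_mul_vel_div hp hφ
  have key : arcPow p (m * p + r + 1) φ * vel p φ / arcSub p φ ^ (m + 1) -
      p * (arcPow p (m * p + r) φ * vel p φ / arcSub p φ ^ m) =
      (((arcRatio p φ ^ m * (gapLogDeriv p φ - p * radLogDeriv p φ)) : ℝ) : ℂ) * arcPow p r φ := by
    calc _ = arcPow p (m * p) φ / arcSub p φ ^ m * arcPow p r φ *
          (arcPow p 1 φ * vel p φ / arcSub p φ - p * vel p φ) := by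
          rw [arcPow_add hp hφ, arcPow_add hp hφ]
          field_simp
          ring
      _ = _ := by
          rw [hm, h1, vel]
          push_cast
          ring
  rw [← Complex.im_ofReal_mul, ← Complex.sub_im, key, Complex.im_ofReal_mul, arcPow,
    Complex.im_ofReal_mul, Complex.exp_ofReal_mul_I_im, density]
  ring

theorem arcInt_combination (hp : 1 < p) (hr : 0 < r) (m : ℕ) :
    (arcInt p (m + 1) (m * p + r + 1) - p * arcInt p m (m * p + r)) / Real.pi =
      raneyNumber p r m := by
  have hpi := Real.pi_pos.ne'
  rcases m with _ | m
  · have h0 := arcInt_zero hp hr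
    have h1 := arcInt_one hp (by linarith : 0 < r + 1)
    simp [h0, h1, raneyNumber, hpi]
  · have hm : (0 : ℝ) ≤ m := m.cast_nonneg
    have ha : (m : ℝ) < ((m + 1 : ℕ) : ℝ) * p + r := by push_cast; nlinarith
    have h1 := arcInt_succ hp (by linarith : 0 < ((m + 1 : ℕ) : ℝ) * p + r) (m + 1)
    have h2 := arcInt_eq hp m ha
    have hm1 : ((m + 1 : ℕ) : ℝ) ≠ 0 := by positivity
    rw [mul_comm, ← eq_div_iff hm1] at h1
    rw [h1, h2, raneyNumber, if_neg (Nat.succ_ne_zero m), Nat.factorial_succ]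
    push_cast at hm1 ⊢
    field_simp
    ring

/-- The law of `arcRatio p φ` when `φ ∈ (0, π/p)` has density `density p r`. -/
noncomputable def arcMeasure (p r : ℝ) : Measure ℝ :=
  ((volume.restrict (Ioo 0 (Real.pi / p))).withDensity
    fun φ => ENNReal.ofReal (density p r φ)).map (arcRatio p)

theorem integrableOn_and_integral_density_mul (hp : 1 < p) (hr : 0 < r) (m : ℕ) :
    IntegrableOn (fun φ => density p r φ * arcRatio p φ ^ m) (Ioo 0 (Real.pi / p)) ∧
    ∫ φ in Ioo 0 (Real.pi / p), density p r φ * arcRatio p φ ^ m = raneyNumber p r m := by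
  have hpos : 0 ≤ Real.pi / p := by positivity
  have ha : 0 < m * p + r := by positivity
  have i1 := intervalIntegrable_arc hp (by linarith : 0 < m * p + r + 1) (m + 1)
  have i2 := (intervalIntegrable_arc hp ha m).const_mul p
  have hcongr : EqOn (fun φ => ((arcPow p (m * p + r + 1) φ * vel p φ / arcSub p φ ^ (m + 1)).im -
        p * (arcPow p (m * p + r) φ * vel p φ / arcSub p φ ^ m).im) / Real.pi)
      (fun φ => density p r φ * arcRatio p φ ^ m) (Ioo 0 (Real.pi / p)) :=
    fun φ hφ => (density_mul_arcRatio_pow hp hφ m).symm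
  constructor
  · refine IntegrableOn.congr_fun ?_ hcongr measurableSet_Ioo
    rw [← intervalIntegrable_iff_integrableOn_Ioo_of_le hpos]
    exact (i1.sub i2).div_const _
  · rw [← setIntegral_congr_fun measurableSet_Ioo hcongr, ← integral_Ioc_eq_integral_Ioo,
      ← intervalIntegral.integral_of_le hpos, intervalIntegral.integral_div,
      intervalIntegral.integral_sub i1 i2, intervalIntegral.integral_const_mul]
    exact arcInt_combination hp hr m

theorem isProbabilityMeasure_arcMeasure (hp : 1 < p) (hr : 0 < r) (hrp : r ≤ p) :
    IsProbabilityMeasure (arcMeasure p r) := by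
  obtain ⟨h1, h2⟩ := integrableOn_and_integral_density_mul hp hr 0
  simp only [pow_zero, mul_one] at h1 h2
  refine ⟨?_⟩
  rw [arcMeasure, Measure.map_apply (measurable_arcRatio p) MeasurableSet.univ, preimage_univ,
    withDensity_apply _ MeasurableSet.univ, Measure.restrict_univ,
    ← ofReal_integral_eq_lintegral_ofReal h1, h2]
  · simp [raneyNumber]
  · exact (ae_restrict_iff' measurableSet_Ioo).2
      (Eventually.of_forall fun φ hφ => density_nonneg hp hr.le hrp hφ)

theorem integral_pow_arcMeasure (hp : 1 < p) (hr : 0 < r) (hrp : r ≤ p) (m : ℕ) :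
    ∫ x, x ^ m ∂arcMeasure p r = raneyNumber p r m := by
  rw [arcMeasure, integral_map (measurable_arcRatio p).aemeasurable (by fun_prop),
    integral_withDensity_eq_integral_toReal_smul (measurable_density p r).ennreal_ofReal (by simp),
    ← (integrableOn_and_integral_density_mul hp hr m).2]
  refine setIntegral_congr_fun measurableSet_Ioo fun φ hφ => ?_
  simp [ENNReal.toReal_ofReal (density_nonneg hp hr.le hrp hφ)]

theorem ae_arcMeasure_mem_Icc (hp : 1 < p) :
    ∀ᵐ x ∂arcMeasure p r, x ∈ Icc 0 (raneyBound p) := by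
  refine (ae_map_iff (p := fun x => x ∈ Icc 0 (raneyBound p)) (measurable_arcRatio p).aemeasurable
    measurableSet_Icc).2 ?_
  refine (withDensity_absolutelyContinuous _ _).ae_le ?_
  exact (ae_restrict_iff' measurableSet_Ioo).2
    (Eventually.of_forall fun φ hφ => ⟨arcRatio_nonneg hp hφ, arcRatio_le hp hφ⟩)

end Density

/-! ### The case `p = 1` -/

section Beta

open ProbabilityTheory

theorem integral_betaPDFReal {α β : ℝ} (hα : 0 < α) (hβ : 0 < β) :
    ∫ x, betaPDFReal α β x = 1 := by
  rw [integral_eq_lintegral_of_nonneg_ae]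
  · have := lintegral_betaPDF_eq_one hα hβ
    simp only [betaPDF] at this
    rw [this, ENNReal.toReal_one]
  · refine Eventually.of_forall fun x => ?_
    by_cases hx : 0 < x ∧ x < 1
    · exact (betaPDFReal_pos hx.1 hx.2 hα hβ).le
    · simp [betaPDFReal, hx]
  · exact (measurable_betaPDFReal α β).aestronglyMeasurable

theorem measurable_betaPDF (α β : ℝ) : Measurable (betaPDF α β) :=
  (measurable_betaPDFReal α β).ennreal_ofReal

theorem raneyNumber_one_eq {r : ℝ} (hr : 0 < r) (hr1 : r < 1) (m : ℕ) :
    raneyNumber 1 r m = beta (r + m) (1 - r) / beta r (1 - r) := by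
  have h1 := (Real.Gamma_pos_of_pos hr).ne'
  have h2 := (Real.Gamma_pos_of_pos (by linarith : 0 < 1 - r)).ne'
  have hG : Real.Gamma (r + m) = Real.Gamma r * ∏ i ∈ Finset.range m, (r + i) := by
    induction m with
    | zero => simp
    | succ m ih =>
      push_cast
      rw [← add_assoc, Real.Gamma_add_one (by positivity), ih, Finset.prod_range_succ]
      ring
  have e : r + m + (1 - r) = m + 1 := by ring
  rw [beta, beta, e, Real.Gamma_nat_eq_factorial, add_sub_cancel, Real.Gamma_one, hG, raneyNumber]
  rcases m with _ | m
  · simp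
    field_simp
  · rw [if_neg (Nat.succ_ne_zero m), Finset.prod_range_succ']
    have : ∏ i ∈ Finset.Ico 1 (m + 1), (((m + 1 : ℕ) : ℝ) * 1 + r - i) =
        ∏ i ∈ Finset.range m, (r + ((i + 1 : ℕ) : ℝ)) := by
      rw [Finset.prod_Ico_eq_prod_range, Nat.add_sub_cancel, ← Finset.prod_range_reflect]
      refine Finset.prod_congr rfl fun i hi => ?_
      have hi' := Finset.mem_range.1 hi
      have : ((m - 1 - i : ℕ) : ℝ) = m - 1 - i := by
        rw [Nat.sub_sub, Nat.cast_sub (by omega)]; push_cast; ring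
      push_cast
      rw [this]
      ring
    rw [this]
    push_cast
    field_simp
    simp

theorem integral_pow_betaMeasure {r : ℝ} (hr : 0 < r) (hr1 : r < 1) (m : ℕ) :
    ∫ x, x ^ m ∂betaMeasure r (1 - r) = raneyNumber 1 r m := by
  have hs : 0 < 1 - r := by linarith
  have hrm : 0 < r + m := by positivity
  have hb := (beta_pos hr hs).ne'
  have hbm := (beta_pos hrm hs).ne'
  have hpt (x : ℝ) : (ENNReal.ofReal (betaPDFReal r (1 - r) x)).toReal • x ^ m =
      raneyNumber 1 r m * betaPDFReal (r + m) (1 - r) x := by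
    rw [raneyNumber_one_eq hr hr1]
    by_cases hx : 0 < x ∧ x < 1
    · rw [ENNReal.toReal_ofReal (betaPDFReal_pos hx.1 hx.2 hr hs).le, betaPDFReal, betaPDFReal,
        if_pos hx, if_pos hx, show r + m - 1 = (r - 1) + m by ring, Real.rpow_add hx.1,
        Real.rpow_natCast, smul_eq_mul]
      field_simp
    · simp [betaPDFReal, hx]
  rw [betaMeasure, integral_withDensity_eq_integral_toReal_smul
    (measurable_betaPDF _ _) (by simp [betaPDF])]
  simp only [betaPDF, hpt]
  rw [integral_const_mul, integral_betaPDFReal hrm hs, mul_one]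

theorem ae_betaMeasure_mem_Icc (α β : ℝ) : ∀ᵐ x ∂betaMeasure α β, x ∈ Icc (0 : ℝ) 1 := by
  rw [betaMeasure, ae_withDensity_iff (measurable_betaPDF _ _)]
  refine Eventually.of_forall fun x hx => ⟨?_, ?_⟩
  · by_contra h
    exact hx (betaPDF_eq_zero_of_nonpos (not_le.1 h).le)
  · by_contra h
    exact hx (betaPDF_eq_zero_of_one_le (not_le.1 h).le)

end Beta

theorem raneyNumber_one_one (m : ℕ) : raneyNumber 1 1 m = 1 := by
  rcases m with _ | m
  · simp [raneyNumber]
  · rw [raneyNumber, if_neg (Nat.succ_ne_zero m), Finset.prod_Ico_eq_prod_range,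
      Nat.add_sub_cancel, ← Finset.prod_range_reflect]
    have : ∏ j ∈ Finset.range m, (((m + 1 : ℕ) : ℝ) * 1 + 1 - ((1 + (m - 1 - j) : ℕ) : ℝ)) =
        ((m + 1).factorial : ℝ) := by
      rw [← Finset.prod_range_add_one_eq_factorial, Finset.prod_range_succ']
      push_cast
      simp only [mul_one]
      refine Finset.prod_congr rfl fun i hi => ?_
      have hi' := Finset.mem_range.1 hi
      have : ((m - 1 - i : ℕ) : ℝ) = m - 1 - i := by
        rw [Nat.sub_sub, Nat.cast_sub (by omega)]; push_cast; ring
      rw [this]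
      ring
    rw [this]
    have := Nat.factorial_ne_zero (m + 1)
    field_simp

theorem raneyBound_one : raneyBound 1 = 1 := by simp [raneyBound]

theorem raneyBound_nonneg {p : ℝ} (hp : 1 ≤ p) : 0 ≤ raneyBound p :=
  div_nonneg (Real.rpow_nonneg (by linarith) _) (Real.rpow_nonneg (by linarith) _)

end Raney

open Raney in
theorem mainTheorem2 (p r : ℝ) (hp : 1 ≤ p) (hr : 0 ≤ r) (hrp : r ≤ p) :
    ∃ μ : MeasureTheory.Measure ℝ,
      MeasureTheory.IsProbabilityMeasure μ ∧
      μ.support ⊆ Set.Icc 0 (raneyBound p) ∧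
      IsMomentSequenceOf (raneyNumber p r) μ ∧
      ∀ ν : MeasureTheory.Measure ℝ, MeasureTheory.IsProbabilityMeasure ν →
        IsMomentSequenceOf (raneyNumber p r) ν → ν = μ := by
  rcases hr.eq_or_lt with rfl | hr
  · refine exists_unique_of_ae_mem_Icc (μ := MeasureTheory.Measure.dirac 0) ?_ fun m => ?_
    · rw [MeasureTheory.ae_dirac_eq]
      exact ⟨le_rfl, raneyBound_nonneg hp⟩
    · rw [MeasureTheory.integral_dirac, raneyNumber]
      rcases m with _ | m <;> simp
  rcases hp.eq_or_lt with rfl | hp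
  · rw [raneyBound_one]
    rcases hrp.eq_or_lt with rfl | hr1
    · refine exists_unique_of_ae_mem_Icc (μ := MeasureTheory.Measure.dirac 1) ?_ fun m => ?_
      · rw [MeasureTheory.ae_dirac_eq]
        exact ⟨zero_le_one, le_rfl⟩
      · rw [MeasureTheory.integral_dirac, raneyNumber_one_one, one_pow]
    · have := ProbabilityTheory.isProbabilityMeasureBeta hr (sub_pos.2 hr1)
      exact exists_unique_of_ae_mem_Icc (ae_betaMeasure_mem_Icc r (1 - r))
        (integral_pow_betaMeasure hr hr1)
  · have := isProbabilityMeasure_arcMeasure hp hr hrp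
    exact exists_unique_of_ae_mem_Icc (ae_arcMeasure_mem_Icc hp) (integral_pow_arcMeasure hp hr hrp)
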